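/- **Theorem 4.1 (Robust mixed integer QP: zero duality gaps).** Let $n,m,s,L\ge 0$ and $q\ge 1$ be integers with $s\le n$; let $a_1,\dots,a_m,c_0,c_1,\dots,c_L\in\mathbb R^n$, $b_1,\dots,b_m\in\mathbb R$, $\xi^{(1)},\dots,\xi^{(q)}\in\mathbb R^L$, $A_0\in\mathbb R^{n\times n}$ and $\rho\ge 0$. Put $$\mathcal U=\Big\{c_0+\sum_{l=1}^L\xi_l c_l:\ \xi\in\mathrm{conv}\{\xi^{(1)},\dots,\xi^{(q)}\}\Big\},\qquad \mathcal V=\{A_0+V:\ V\in\mathbb R^{n\times n}\text{ symmetric},\ \|V\|_{\rm spec}\le\rho\},$$ where $\|V\|_{\rm spec}=\sqrt{\lambda_{\max}(V^TV)}$, and consider the robust mixed integer quadratic program $$(RP)\qquad \inf_{x\in C}\ \max_{(c,A)\in\mathcal U\times\mathcal V}\{x^TAx+c^Tx\},\qquad C=\{x\in\mathbb R^n_+:\ a_j^Tx=b_j\ (1\le j\le m),\ x_i\in\{0,1\}\ (1\le i\le s)\}.$$ Assume that $C\ne\emptyset$, that (RA) every $d\in\mathbb R^n_+$ with $a_j^Td=b_j$,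 $j=1,\dots,m$, satisfies $0\le d_i\le 1$ for $i=1,\dots,s$, and that $\{d\in\mathbb R^n_+:\ a_j^Td=0\ (1\le j\le m),\ d_i=0\ (1\le i\le s)\}=\{0\}$. Let $M=\max\big\{\max_{x\in C,\,1\le k\le q}\{c_0^Tx+\sum_{l=1}^L\xi^{(k)}_l c_l^Tx\},\,0\big\}$. Let $N=n+q+4$ and $r=m+q+2$, write vectors of $\mathbb R^N$ as $z=(x,t_1,t_2,v)\in\mathbb R^n\times\mathbb R\times\mathbb R\times\mathbb R^{q+2}$, let $W\in\mathbb R^{N\times N}$ have upper left $n\times n$ block $A_0+\rho I_n$ and all other entries $0$, let $w=(0,1,-1,0)$, and let $$\bar a_j=(a_j,0,0,0),\quad \bar b_j=b_j\quad(1\le j\le m),$$ $$\bar a_{m+k}=\Big(c_0+\sum_{l=1}^L\xi^{(k)}_l c_l,\,-1,\,1,\,e_k\Big),\quad \bar b_{m+k}=0\quad(1\le k\le q),$$ $$\bar a_{m+q+1}=(0,1,0,e_{q+1}),\quad \bar a_{m+q+2}=(0,1,-1,e_{q+2}),\quad \bar b_{m+q+1}=\bar b_{m+q+2}=M,$$ with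 $e_1,\dots,e_{q+2}$ the standard basis of $\mathbb R^{q+2}$. Let $g_1,\dots,g_{4r+2s}$ be the functions on $\mathbb R^N$ $$\bar a_j^Tz-\bar b_j,\quad -\bar a_j^Tz+\bar b_j,\quad (\bar a_j^Tz)^2-\bar b_j^2,\quad -(\bar a_j^Tz)^2+\bar b_j^2\quad(1\le j\le r),\qquad z_i(z_i-1),\quad -z_i(z_i-1)\quad(1\le i\le s),$$ and define the semi-Lagrangian dual $$(D_{RP})\qquad \sup_{u\in\mathbb R^{4r+2s}_+}\ \inf_{z\in\mathbb R^N_+}\Big\{z^TWz+w^Tz+\sum_{k=1}^{4r+2s}u_k\,g_k(z)\Big\}.$$ Then the maximum defining $M$ exists, and $\inf(RP)=\sup(D_{RP})$ (as elements of $[-\infty,+\infty]$). -/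

import Mathlib

/-- The largest eigenvalue of a real square matrix (meant for symmetric matrices: the maximum of
its finite real spectrum). -/
noncomputable def lambdaMax {n : ℕ} (A : Matrix (Fin n) (Fin n) ℝ) : ℝ :=
  sSup (spectrum ℝ A)

/-- The spectral norm `√(λ_max(AᵀA))`. -/
noncomputable def specNorm {n : ℕ} (A : Matrix (Fin n) (Fin n) ℝ) : ℝ :=
  √(lambdaMax (A.transpose * A))

/-- The optimal value, in `[-∞, +∞]`, of the semi-Lagrangian dual of
`inf { f x | x ≥ 0, g k x ≤ 0 for all k }`: the constraints `g k x ≤ 0` are dualized with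
multipliers `u k ≥ 0`, and the Lagrangian is minimized over the nonnegative orthant. -/
noncomputable def semiLagrangianDual {ι κ : Type} [Fintype κ]
    (f : (ι → ℝ) → ℝ) (g : κ → (ι → ℝ) → ℝ) : EReal :=
  ⨆ u : κ → ℝ, ⨆ _ : 0 ≤ u, ⨅ x : ι → ℝ, ⨅ _ : 0 ≤ x,
    ((f x + ∑ k, u k * g k x : ℝ) : EReal)

/-- The data of a robust mixed-integer quadratic program in `n` variables with `m` linear
equality constraints, the first `s ≤ n` variables being binary; the linear part of the objective
is uncertain in a polytope generated by `q` points `ξ k` of `ℝ^L`, and the quadratic part is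
uncertain in a spectral-norm ball of radius `ρ` around `A₀`. -/
structure RobustMIQP (n m s L q : ℕ) where
  hs : s ≤ n
  a : Fin m → Fin n → ℝ
  b : Fin m → ℝ
  c₀ : Fin n → ℝ
  c : Fin L → Fin n → ℝ
  ξ : Fin q → Fin L → ℝ
  A₀ : Matrix (Fin n) (Fin n) ℝ
  ρ : ℝ

namespace RobustMIQP

variable {n m s L q : ℕ} (P : RobustMIQP n m s L q)

/-- The index, among all variables, of the `i`-th binary variable. -/
def bin (i : Fin s) : Fin n := Fin.castLE P.hs i

/-- The polytopic uncertainty set for the linear part of the objective. -/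
def U : Set (Fin n → ℝ) :=
  {v | ∃ ζ ∈ convexHull ℝ (Set.range P.ξ), v = P.c₀ + ∑ l, ζ l • P.c l}

/-- The spectral-norm uncertainty set for the quadratic part of the objective. -/
def V : Set (Matrix (Fin n) (Fin n) ℝ) :=
  {A | ∃ E : Matrix (Fin n) (Fin n) ℝ, E.IsSymm ∧ specNorm E ≤ P.ρ ∧ A = P.A₀ + E}

/-- The feasible set of the robust program. -/
def feasibleSet : Set (Fin n → ℝ) :=
  {x | (∀ j, P.a j ⬝ᵥ x = P.b j) ∧ 0 ≤ x ∧ ∀ i, x (P.bin i) = 0 ∨ x (P.bin i) = 1}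

/-- The worst-case objective: the supremum of `xᵀAx + cᵀx` over the uncertainty set. -/
noncomputable def worstCase (x : Fin n → ℝ) : EReal :=
  ⨆ v ∈ P.U, ⨆ A ∈ P.V, ((x ⬝ᵥ (A.mulVec x) + v ⬝ᵥ x : ℝ) : EReal)

/-- The optimal value of the robust program. -/
noncomputable def infRP : EReal :=
  ⨅ x ∈ P.feasibleSet, P.worstCase x

/-- The regularity assumption: the linear constraints together with nonnegativity force the
binary variables into `[0, 1]`. -/
def RA : Prop :=
  ∀ d : Fin n → ℝ, 0 ≤ d → (∀ j, P.a j ⬝ᵥ d = P.b j) →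
    ∀ i, 0 ≤ d (P.bin i) ∧ d (P.bin i) ≤ 1

/-- The vector `c₀ + ∑ l, ξ⁽ᵏ⁾_l c_l`. -/
def vertexCost (k : Fin q) : Fin n → ℝ :=
  P.c₀ + ∑ l, P.ξ k l • P.c l

/-- The set of the values `c₀ᵀx + ∑ l, ξ⁽ᵏ⁾_l c_lᵀx` for feasible `x` and all `k`. -/
def vertexValues : Set ℝ :=
  {r | ∃ x ∈ P.feasibleSet, ∃ k, r = P.vertexCost k ⬝ᵥ x}

/-- The constant `M = max { max_{x ∈ C, k} (c₀ᵀx + ∑ l, ξ⁽ᵏ⁾_l c_lᵀx), 0 }`. -/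
noncomputable def M : ℝ := max (sSup P.vertexValues) 0

/-- Index type of the `n + 2 + (q + 2)` coordinates of `z = (x, (t₁, t₂), v)`. -/
abbrev Var (n q : ℕ) : Type := Fin n ⊕ (Fin 2 ⊕ Fin (q + 2))

/-- Index type of the `m + q + 2` linear equations of the reformulation. -/
abbrev Lin (m q : ℕ) : Type := Fin m ⊕ (Fin q ⊕ Fin 2)

/-- The matrix with upper left block `A₀ + ρ I` and all other entries zero. -/
def W : Matrix (Var n q) (Var n q) ℝ :=
  Matrix.fromBlocks (P.A₀ + P.ρ • (1 : Matrix (Fin n) (Fin n) ℝ)) 0 0 0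

/-- The vector `(0, 1, -1, 0)`. -/
def w (n q : ℕ) : Var n q → ℝ := Sum.elim 0 (Sum.elim ![1, -1] 0)

/-- The coefficient vectors of the linear equations of the reformulation:
`(a_j, 0, 0, 0)`, `(c₀ + ∑ l, ξ⁽ᵏ⁾_l c_l, -1, 1, e_k)`, `(0, 1, 0, e_{q+1})` and
`(0, 1, -1, e_{q+2})`. -/
def aBar : Lin m q → Var n q → ℝ
  | .inl j => Sum.elim (P.a j) 0
  | .inr (.inl k) =>
      Sum.elim (P.vertexCost k) (Sum.elim ![-1, 1] (Pi.single (Fin.castAdd 2 k) 1))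
  | .inr (.inr r) =>
      Sum.elim 0 (Sum.elim (![![1, 0], ![1, -1]] r) (Pi.single (Fin.natAdd q r) 1))

/-- The right-hand sides of the linear equations of the reformulation. -/
noncomputable def bBar : Lin m q → ℝ
  | .inl j => P.b j
  | .inr (.inl _) => 0
  | .inr (.inr _) => P.M

/-- The objective `zᵀWz + wᵀz` of the reformulation. -/
def f (z : Var n q → ℝ) : ℝ := z ⬝ᵥ (P.W.mulVec z) + w n q ⬝ᵥ z

/-- The `4 (m + q + 2) + 2 s` constraint functions of the reformulation. -/
noncomputable def g :
    (Lin m q ⊕ Lin m q) ⊕ (Lin m q ⊕ Lin m q) ⊕ (Fin s ⊕ Fin s) → (Var n q → ℝ) → ℝ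
  | .inl (.inl j), z => P.aBar j ⬝ᵥ z - P.bBar j
  | .inl (.inr j), z => -(P.aBar j ⬝ᵥ z) + P.bBar j
  | .inr (.inl (.inl j)), z => (P.aBar j ⬝ᵥ z) ^ 2 - P.bBar j ^ 2
  | .inr (.inl (.inr j)), z => -(P.aBar j ⬝ᵥ z) ^ 2 + P.bBar j ^ 2
  | .inr (.inr (.inl i)), z => z (.inl (P.bin i)) * (z (.inl (P.bin i)) - 1)
  | .inr (.inr (.inr i)), z => -(z (.inl (P.bin i)) * (z (.inl (P.bin i)) - 1))

/-- The optimal value of the semi-Lagrangian dual of the robust program. -/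
noncomputable def supDRP : EReal := semiLagrangianDual P.f P.g

end RobustMIQP

/-! The worst quadratic perturbation is `ρ • 1` and the worst linear cost sits at one of the `q`
generators, so (RP) is the mixed-binary program of minimizing `f` over `liftedSet`, with `t₁ - t₂`
as epigraph variable and `v` as slacks. All `g` vanish on that set, which gives weak duality.

For the converse take `r < infRP` and homogenize with a variable `τ ≥ 0`. If a convex combination of
nonzero points `(τ, z) ≥ 0` satisfies the homogenized constraints on average, then each point of
positive weight satisfies them: linear and squared constraints combine into squares, and (RA) gives
the binary terms one sign. Trivial recession directions force `τ > 0`, so each such point rescales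
into `liftedSet`, where `f > r` (`sum_homObjective_pos`). Hence a convex hull misses a closed convex
cone; by compactness they separate strictly, with no constraint qualification
(`exists_multiplier_of_isCompact`), and setting `τ = 1` yields dual multipliers of value at least
`r`. -/

/-! ### Convex hulls and separation over a compact set. -/

/-- By Carathéodory, `dim + 1` points suffice, so the hull is a continuous image of a simplex times
a power of `s`; unused places get weight zero and the point `z₀`. -/
theorem isCompact_convexHull_of_isCompact {E : Type*} [NormedAddCommGroup E] [NormedSpace ℝ E]
    [FiniteDimensional ℝ E] {s : Set E} (hs : IsCompact s) : IsCompact (convexHull ℝ s) := by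
  rcases s.eq_empty_or_nonempty with rfl | ⟨z₀, hz₀⟩
  · simp
  let κ := Fin (Module.finrank ℝ E + 1)
  have hK : IsCompact ((stdSimplex ℝ κ) ×ˢ (Set.univ.pi fun _ : κ => s)) :=
    (isCompact_stdSimplex ℝ κ).prod (isCompact_univ_pi fun _ => hs)
  have hf : Continuous fun p : (κ → ℝ) × (κ → E) => ∑ i, p.1 i • p.2 i := by fun_prop
  convert hK.image hf
  ext x
  constructor
  · intro hx
    obtain ⟨ι, _, z, w, hz, hind, hw, hw1, rfl⟩ := eq_pos_convex_span_of_mem_convexHull hx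
    have hcard : Fintype.card ι ≤ Fintype.card κ := by
      have := hind.card_le_finrank_succ
      have h2 := Submodule.finrank_le (vectorSpan ℝ (Set.range z))
      simp only [κ, Fintype.card_fin]
      omega
    obtain ⟨e⟩ := Function.Embedding.nonempty_of_card_le hcard
    have hext : ∀ i ∉ Set.range e, Function.extend e w 0 i = 0 := fun i hi => by
      rw [Function.extend_apply' _ _ _ (by simpa using hi)]; rfl
    refine ⟨(Function.extend e w 0, Function.extend e z fun _ => z₀), ⟨⟨fun i => ?_, ?_⟩,
      fun i _ => ?_⟩, ?_⟩
    · by_cases hi : i ∈ Set.range e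
      · obtain ⟨j, rfl⟩ := hi
        simpa [e.injective.extend_apply] using (hw j).le
      · exact (hext i hi).ge
    · rw [← hw1]
      exact (Fintype.sum_of_injective e e.injective _ _ hext
        fun i => by simp [e.injective.extend_apply]).symm
    · by_cases hi : i ∈ Set.range e
      · obtain ⟨j, rfl⟩ := hi
        simpa [e.injective.extend_apply] using hz ⟨j, rfl⟩
      · simpa [Function.extend_apply' _ _ _ (show ¬ ∃ a, e a = i by simpa using hi)] using hz₀
    · exact (Fintype.sum_of_injective e e.injective _ _ (fun i hi => by simp [hext i hi])
        fun i => by simp [e.injective.extend_apply]).symm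
  · rintro ⟨⟨w, z⟩, ⟨⟨hw, hw1⟩, hz⟩, rfl⟩
    exact (convex_convexHull ℝ s).sum_mem (fun i _ => hw i) hw1
      fun i _ => subset_convexHull ℝ s (hz i trivial)

/-- A theorem of the alternative over a compact set. -/
theorem exists_multiplier_of_isCompact {E κ : Type*} [TopologicalSpace E] [Fintype κ]
    {X : Set E} (hX : IsCompact X) {F : E → ℝ} {G : κ → E → ℝ} (hF : Continuous F)
    (hG : ∀ k, Continuous (G k))
    (h : ∀ (ι : Type) (t : Finset ι) (p : ι → ℝ) (y : ι → E), (∀ i ∈ t, 0 ≤ p i) →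
      ∑ i ∈ t, p i = 1 → (∀ i ∈ t, y i ∈ X) → (∀ k, ∑ i ∈ t, p i * G k (y i) = 0) →
      0 < ∑ i ∈ t, p i * F (y i)) :
    ∃ μ : κ → ℝ, ∀ y ∈ X, 0 < F y + ∑ k, μ k * G k y := by
  classical
  let φ : E → ℝ × (κ → ℝ) := fun y => (F y, fun k => G k y)
  have hφ : Continuous φ := by fun_prop
  have hS : IsCompact (convexHull ℝ (φ '' X)) := isCompact_convexHull_of_isCompact (hX.image hφ)
  have hT : IsClosed (Set.Iic (0 : ℝ) ×ˢ ({0} : Set (κ → ℝ))) := isClosed_Iic.prod isClosed_singleton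
  have hdisj : Disjoint (convexHull ℝ (φ '' X)) (Set.Iic (0 : ℝ) ×ˢ ({0} : Set (κ → ℝ))) := by
    rw [Set.disjoint_left]
    rintro x hx ⟨hx1, hx2⟩
    rw [convexHull_eq] at hx
    obtain ⟨ι, t, p, z, hp, hp1, hz, rfl⟩ := hx
    rw [Finset.centerMass_eq_of_sum_1 _ _ hp1] at hx1 hx2
    rcases t.eq_empty_or_nonempty with rfl | ⟨i₀, hi₀⟩
    · simp at hp1
    obtain ⟨y₀, -, -⟩ := hz i₀ hi₀
    have : ∀ i, ∃ y, i ∈ t → y ∈ X ∧ φ y = z i := fun i => by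
      by_cases hi : i ∈ t
      · obtain ⟨y, hy⟩ := hz i hi
        exact ⟨y, fun _ => hy⟩
      · exact ⟨y₀, fun h => absurd h hi⟩
    choose y hy using this
    have hsum : ∑ i ∈ t, p i • z i = ∑ i ∈ t, p i • φ (y i) :=
      Finset.sum_congr rfl fun i hi => by rw [(hy i hi).2]
    rw [hsum] at hx1 hx2
    refine absurd (h ι t p y hp hp1 (fun i hi => (hy i hi).1) fun k => ?_) ?_
    · have := congrFun (Set.mem_singleton_iff.1 hx2) k
      simpa [φ, Prod.snd_sum, Finset.sum_apply] using this
    · simpa [φ, Prod.fst_sum] using hx1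
  obtain ⟨ℓ, u, v, hu, huv, hv⟩ := geometric_hahn_banach_compact_closed
    (convex_convexHull ℝ _) hS ((convex_Iic 0).prod (convex_singleton 0)) hT hdisj
  have hv0 : v < 0 := by simpa using hv 0 (by simp)
  let α := -ℓ (1, 0)
  let μ : κ → ℝ := fun k => -ℓ (0, Pi.single k 1)
  have hℓ : ∀ y, ℓ (φ y) = -(α * F y + ∑ k, μ k * G k y) := fun y => by
    have : φ y = F y • ((1 : ℝ), (0 : κ → ℝ)) + ∑ k, G k y • ((0 : ℝ), (Pi.single k 1 : κ → ℝ)) := by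
      refine Prod.ext (by simp [φ, Prod.fst_sum]) ?_
      ext k
      simp [φ, Prod.snd_sum, Finset.sum_apply, Pi.single_apply]
    rw [this, map_add, map_sum]
    simp only [map_smul, smul_eq_mul, α, μ, neg_mul, Finset.sum_neg_distrib]
    rw [neg_add, neg_neg, neg_neg]
    simp only [mul_comm]
  have hpos : ∀ y ∈ X, 0 < α * F y + ∑ k, μ k * G k y := fun y hy => by
    have := hu _ (subset_convexHull ℝ _ ⟨y, hy, rfl⟩)
    rw [hℓ] at this
    linarith
  have hα : 0 ≤ α := by
    by_contra! hneg
    -- If `α < 0`, this point of the cone has `ℓ`-value exactly `v`, against strict separation.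
    have hmem : ((v / (-α)), (0 : κ → ℝ)) ∈ Set.Iic (0 : ℝ) ×ˢ ({0} : Set (κ → ℝ)) :=
      ⟨div_nonpos_of_nonpos_of_nonneg hv0.le (by linarith), rfl⟩
    have h1 := hv _ hmem
    have h2 : ((v / (-α)), (0 : κ → ℝ)) = (v / (-α)) • ((1 : ℝ), (0 : κ → ℝ)) := by simp
    rw [h2, map_smul, smul_eq_mul, show ℓ (1, 0) = -α by simp [α],
      div_mul_cancel₀ _ (by linarith)] at h1
    exact lt_irrefl _ h1
  -- In the degenerate case `α = 0` the constraint part alone is at least some `δ > 0` on `X`, so a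
  -- large multiple of it outweighs the minimum of `F`.
  rcases hα.eq_or_lt with h0 | hα
  · rcases X.eq_empty_or_nonempty with rfl | hne
    · exact ⟨0, by simp⟩
    have hH : Continuous fun y => ∑ k, μ k * G k y := by fun_prop
    obtain ⟨y₁, hy₁, hmin₁⟩ := hX.exists_isMinOn hne hH.continuousOn
    obtain ⟨y₂, hy₂, hmin₂⟩ := hX.exists_isMinOn hne hF.continuousOn
    have hδ : 0 < ∑ k, μ k * G k y₁ := by simpa [← h0] using hpos y₁ hy₁
    set δ := ∑ k, μ k * G k y₁
    set c := (|F y₂| + 1) / δ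
    have hc : 0 < c := by positivity
    refine ⟨fun k => c * μ k, fun y hy => ?_⟩
    have h1 : δ ≤ ∑ k, μ k * G k y := hmin₁ hy
    have h2 : F y₂ ≤ F y := hmin₂ hy
    have h3 : ∑ k, c * μ k * G k y = c * ∑ k, μ k * G k y := by
      simp [Finset.mul_sum, mul_assoc]
    have h4 : c * δ = |F y₂| + 1 := div_mul_cancel₀ _ hδ.ne'
    have h5 := mul_le_mul_of_nonneg_left h1 hc.le
    have := neg_abs_le (F y₂)
    rw [h3]
    linarith
  · refine ⟨fun k => μ k / α, fun y hy => ?_⟩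
    have h3 : F y + ∑ k, μ k / α * G k y = (α * F y + ∑ k, μ k * G k y) / α := by
      rw [add_div, mul_div_cancel_left₀ _ hα.ne', Finset.sum_div]
      simp [div_mul_eq_mul_div]
    rw [h3]
    exact div_pos (hpos y hy) hα

/-! ### The spectral-norm ball. -/

theorem spectrum_transpose_mul_self_le {n : ℕ} {E : Matrix (Fin n) (Fin n) ℝ} {ρ : ℝ}
    (hρ : 0 ≤ ρ) (h : specNorm E ≤ ρ) {μ : ℝ} (hμ : μ ∈ spectrum ℝ (E.transpose * E)) :
    μ ≤ ρ ^ 2 := by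
  have h1 : lambdaMax (E.transpose * E) ≤ ρ ^ 2 := (Real.sqrt_le_left hρ).1 h
  exact (le_csSup (Matrix.finite_spectrum _).bddAbove hμ).trans h1

/-- For symmetric `E`, `EᵀE = E²`, so each eigenvalue `l` has `l² ≤ ρ²` and `ρI - E` is positive
semidefinite. -/
theorem dotProduct_mulVec_le_of_specNorm_le {n : ℕ} {E : Matrix (Fin n) (Fin n) ℝ} {ρ : ℝ}
    (hρ : 0 ≤ ρ) (hE : E.IsSymm) (h : specNorm E ≤ ρ) (x : Fin n → ℝ) :
    x ⬝ᵥ E.mulVec x ≤ ρ * (x ⬝ᵥ x) := by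
  have hpsd : (algebraMap ℝ (Matrix (Fin n) (Fin n) ℝ) ρ - E).PosSemidef := by
    rw [Matrix.posSemidef_iff_isHermitian_and_spectrum_nonneg]
    constructor
    · have : E.IsHermitian := by rw [Matrix.IsHermitian, Matrix.conjTranspose_eq_transpose_of_trivial, hE]
      refine Matrix.IsHermitian.sub ?_ this
      rw [Algebra.algebraMap_eq_smul_one, Matrix.IsHermitian,
        Matrix.conjTranspose_eq_transpose_of_trivial]
      simp
    · rw [← spectrum.singleton_sub_eq, Set.singleton_sub]
      rintro _ ⟨l, hl, rfl⟩
      have h2 := spectrum_transpose_mul_self_le hρ h (μ := l ^ 2) (by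
        rw [hE.eq, ← sq]
        exact spectrum.pow_mem_pow E 2 hl)
      have := abs_le_of_sq_le_sq' h2 hρ
      show 0 ≤ ρ - l
      linarith [this.2]
  have := hpsd.dotProduct_mulVec_nonneg x
  simp only [Algebra.algebraMap_eq_smul_one, Matrix.sub_mulVec, Matrix.smul_mulVec,
    Matrix.one_mulVec, dotProduct_sub, dotProduct_smul, smul_eq_mul, star_trivial] at this
  linarith

theorem specNorm_smul_one_le {n : ℕ} {ρ : ℝ} (hρ : 0 ≤ ρ) :
    specNorm (ρ • (1 : Matrix (Fin n) (Fin n) ℝ)) ≤ ρ := by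
  refine Real.sqrt_le_iff.2 ⟨hρ, Real.sSup_le (fun l hl => ?_) (sq_nonneg ρ)⟩
  rcases subsingleton_or_nontrivial (Matrix (Fin n) (Fin n) ℝ) with _ | _
  · simp [spectrum.of_subsingleton] at hl
  · have : (ρ • (1 : Matrix (Fin n) (Fin n) ℝ)).transpose * (ρ • (1 : Matrix (Fin n) (Fin n) ℝ)) =
        algebraMap ℝ _ (ρ ^ 2) := by
      simp [Algebra.algebraMap_eq_smul_one, smul_smul, sq]
    rw [this, spectrum.scalar_eq] at hl
    exact le_of_eq hl

namespace RobustMIQP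

variable {n m s L q : ℕ} (P : RobustMIQP n m s L q)

/-! ### The worst case over the uncertainty sets. -/

theorem vertexCost_mem_U (k : Fin q) : P.vertexCost k ∈ P.U :=
  ⟨P.ξ k, subset_convexHull ℝ _ ⟨k, rfl⟩, rfl⟩

theorem dotProduct_le_of_mem_U {v : Fin n → ℝ} (hv : v ∈ P.U) {x : Fin n → ℝ} {T : ℝ}
    (hT : ∀ k, P.vertexCost k ⬝ᵥ x ≤ T) : v ⬝ᵥ x ≤ T := by
  obtain ⟨ζ, hζ, rfl⟩ := hv
  have hconv : Convex ℝ {ζ : Fin L → ℝ | (P.c₀ + ∑ l, ζ l • P.c l) ⬝ᵥ x ≤ T} := by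
    intro ζ₁ h₁ ζ₂ h₂ a b ha hb hab
    simp only [Set.mem_ofPred_eq, add_dotProduct, sum_dotProduct, smul_dotProduct, smul_eq_mul,
      Pi.add_apply, Pi.smul_apply] at *
    have e : ∑ l, (a * ζ₁ l + b * ζ₂ l) * (P.c l ⬝ᵥ x) =
        a * ∑ l, ζ₁ l * (P.c l ⬝ᵥ x) + b * ∑ l, ζ₂ l * (P.c l ⬝ᵥ x) := by
      rw [Finset.mul_sum, Finset.mul_sum, ← Finset.sum_add_distrib]
      exact Finset.sum_congr rfl fun l _ => by ring
    rw [e]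
    obtain rfl : b = 1 - a := by linarith
    nlinarith [mul_le_mul_of_nonneg_left h₁ ha, mul_le_mul_of_nonneg_left h₂ hb]
  have := convexHull_min (s := Set.range P.ξ) (by rintro _ ⟨k, rfl⟩; exact hT k) hconv hζ
  exact this

/-- The robust quadratic form `xᵀ(A₀ + ρI)x`. -/
def robustForm (x : Fin n → ℝ) : ℝ :=
  x ⬝ᵥ (P.A₀ + P.ρ • (1 : Matrix (Fin n) (Fin n) ℝ)).mulVec x

theorem worstCase_le (hρ : 0 ≤ P.ρ) {x : Fin n → ℝ} {T : ℝ}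
    (hT : ∀ k, P.vertexCost k ⬝ᵥ x ≤ T) : P.worstCase x ≤ ((P.robustForm x + T : ℝ) : EReal) := by
  refine iSup₂_le fun v hv => iSup₂_le fun A hA => EReal.coe_le_coe_iff.2 ?_
  obtain ⟨E, hE, hEρ, rfl⟩ := hA
  have h1 := P.dotProduct_le_of_mem_U hv hT
  have h2 := dotProduct_mulVec_le_of_specNorm_le hρ hE hEρ x
  simp only [robustForm, Matrix.add_mulVec, Matrix.smul_mulVec, Matrix.one_mulVec, dotProduct_add,
    dotProduct_smul, smul_eq_mul]
  linarith

theorem le_worstCase (hρ : 0 ≤ P.ρ) (x : Fin n → ℝ) (k : Fin q) :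
    ((P.robustForm x + P.vertexCost k ⬝ᵥ x : ℝ) : EReal) ≤ P.worstCase x := by
  have hA : P.A₀ + P.ρ • (1 : Matrix (Fin n) (Fin n) ℝ) ∈ P.V :=
    ⟨_, by simp [Matrix.IsSymm], specNorm_smul_one_le hρ, rfl⟩
  exact le_iSup₂_of_le (P.vertexCost k) (P.vertexCost_mem_U k) (le_iSup₂_of_le _ hA le_rfl)

/-! ### Recession directions, compactness of the feasible set, existence of `M`. -/

theorem eq_zero_of_dotProduct_eq_zero (hC : P.feasibleSet.Nonempty) (hRA : P.RA)
    (hd : {d : Fin n → ℝ | 0 ≤ d ∧ (∀ j, P.a j ⬝ᵥ d = 0) ∧ ∀ i, d (P.bin i) = 0} = {0})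
    {d : Fin n → ℝ} (hd0 : 0 ≤ d) (had : ∀ j, P.a j ⬝ᵥ d = 0) : d = 0 := by
  obtain ⟨x, hx, hx0, -⟩ := hC
  have : d ∈ {d : Fin n → ℝ | 0 ≤ d ∧ (∀ j, P.a j ⬝ᵥ d = 0) ∧ ∀ i, d (P.bin i) = 0} := by
    refine ⟨hd0, had, fun i => le_antisymm ?_ (hd0 _)⟩
    by_contra! hpos
    -- Moving from `x` by this multiple of `d` raises the binary coordinate to at least 2, against
    -- (RA).
    have h1 : 0 ≤ 2 / d (P.bin i) := by positivity
    have h2 := (hRA (x + (2 / d (P.bin i)) • d) (add_nonneg hx0 (smul_nonneg h1 hd0))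
      (fun j => by rw [dotProduct_add, dotProduct_smul, had, hx, smul_zero, add_zero]) i).2
    have h3 := hx0 (P.bin i)
    simp only [Pi.add_apply, Pi.smul_apply, smul_eq_mul, Pi.zero_apply] at h2 h3
    rw [div_mul_cancel₀ _ hpos.ne'] at h2
    linarith
  rw [hd] at this
  exact this

/-- With no nonzero recession direction, `∑ j, |a_j ⬝ᵥ x|` has a positive minimum `δ` on nonnegative
unit vectors, whence `‖x‖ ≤ (∑ j, |b_j|) / δ`. -/
theorem isCompact_feasibleSet (hC : P.feasibleSet.Nonempty) (hRA : P.RA)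
    (hd : {d : Fin n → ℝ | 0 ≤ d ∧ (∀ j, P.a j ⬝ᵥ d = 0) ∧ ∀ i, d (P.bin i) = 0} = {0}) :
    IsCompact P.feasibleSet := by
  have hdot : ∀ v : Fin n → ℝ, Continuous fun x : Fin n → ℝ => v ⬝ᵥ x := fun v => by
    simp only [dotProduct]; fun_prop
  refine Metric.isCompact_of_isClosed_isBounded ?_ ?_
  · have : P.feasibleSet = (⋂ j, {x | P.a j ⬝ᵥ x = P.b j}) ∩ (Set.Ici 0 ∩
        ⋂ i, ({x | x (P.bin i) = 0} ∪ {x | x (P.bin i) = 1})) := by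
      ext x; simp [feasibleSet]
    rw [this]
    refine (isClosed_iInter fun j => isClosed_eq (hdot _) continuous_const).inter
      (isClosed_Ici.inter (isClosed_iInter fun i => ?_))
    exact (isClosed_eq (continuous_apply _) continuous_const).union
      (isClosed_eq (continuous_apply _) continuous_const)
  · let X : Set (Fin n → ℝ) := Metric.sphere 0 1 ∩ Set.Ici 0
    have hX : IsCompact X := (isCompact_sphere 0 1).inter_right isClosed_Ici
    have hH : Continuous fun x : Fin n → ℝ => ∑ j, |P.a j ⬝ᵥ x| :=
      continuous_finsetSum _ fun j _ => (hdot _).abs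
    -- The empty case is `n = 0`.
    rcases X.eq_empty_or_nonempty with hXe | hne
    · refine (Metric.isBounded_closedBall (x := (0 : Fin n → ℝ)) (r := 0)).subset fun x hx => ?_
      by_contra hx'
      have hx0 : x ≠ 0 := by rintro rfl; simp at hx'
      refine (Set.eq_empty_iff_forall_notMem.1 hXe) (‖x‖⁻¹ • x) ⟨?_, ?_⟩
      · simp [norm_smul, hx0]
      · exact smul_nonneg (by positivity) hx.2.1
    obtain ⟨y, hy, hmin⟩ := hX.exists_isMinOn hne hH.continuousOn
    set δ := ∑ j, |P.a j ⬝ᵥ y| with hδdef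
    have hδ : 0 < δ := by
      refine lt_of_le_of_ne (Finset.sum_nonneg fun _ _ => abs_nonneg _) fun h0 => ?_
      have h1 := (Finset.sum_eq_zero_iff_of_nonneg fun _ _ => abs_nonneg _).1 h0.symm
      have := P.eq_zero_of_dotProduct_eq_zero hC hRA hd hy.2
        fun j => abs_eq_zero.1 (h1 j (Finset.mem_univ j))
      simpa [this] using hy.1
    refine (Metric.isBounded_closedBall (x := (0 : Fin n → ℝ))
      (r := (∑ j, |P.b j|) / δ)).subset fun x hx => ?_
    rw [mem_closedBall_zero_iff, le_div_iff₀ hδ]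
    rcases eq_or_ne x 0 with rfl | hx0
    · simpa using Finset.sum_nonneg fun j _ => abs_nonneg (P.b j)
    have hn : 0 < ‖x‖ := norm_pos_iff.2 hx0
    have h1 : δ ≤ ∑ j, |P.a j ⬝ᵥ (‖x‖⁻¹ • x)| := by
      refine hmin (show ‖x‖⁻¹ • x ∈ X from ⟨?_, smul_nonneg (by positivity) hx.2.1⟩)
      simp [norm_smul, hx0]
    have h2 : ∑ j, |P.a j ⬝ᵥ (‖x‖⁻¹ • x)| = ‖x‖⁻¹ * ∑ j, |P.b j| := by
      rw [Finset.mul_sum]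
      refine Finset.sum_congr rfl fun j _ => ?_
      rw [dotProduct_smul, hx.1 j, smul_eq_mul, abs_mul, abs_of_pos (inv_pos.2 hn)]
    rw [h2] at h1
    calc ‖x‖ * δ ≤ ‖x‖ * (‖x‖⁻¹ * ∑ j, |P.b j|) := by gcongr
      _ = _ := mul_inv_cancel_left₀ hn.ne' _

theorem isGreatest_M (hq : 0 < q) (hC : P.feasibleSet.Nonempty) (hK : IsCompact P.feasibleSet) :
    IsGreatest (insert 0 P.vertexValues) P.M := by
  have hV : P.vertexValues = ⋃ k, (fun x => P.vertexCost k ⬝ᵥ x) '' P.feasibleSet := by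
    ext r
    simp only [vertexValues, Set.mem_ofPred_eq, Set.mem_iUnion, Set.mem_image]
    constructor
    · rintro ⟨x, hx, k, rfl⟩; exact ⟨k, x, hx, rfl⟩
    · rintro ⟨k, x, hx, rfl⟩; exact ⟨x, hx, k, rfl⟩
  have hcomp : IsCompact P.vertexValues := by
    rw [hV]
    refine isCompact_iUnion fun k => hK.image ?_
    simp only [dotProduct]; fun_prop
  obtain ⟨x, hx⟩ := hC
  have hg := hcomp.isGreatest_sSup ⟨_, x, hx, ⟨0, hq⟩, rfl⟩
  have := hg.insert 0
  rwa [max_comm] at this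

/-! ### The lifted program in standard form. -/

theorem aBar_inl_dotProduct (j : Fin m) (z : Var n q → ℝ) :
    P.aBar (.inl j) ⬝ᵥ z = P.a j ⬝ᵥ (z ∘ Sum.inl) := by
  simp [aBar, dotProduct]

theorem aBar_vertex_dotProduct (k : Fin q) (z : Var n q → ℝ) :
    P.aBar (.inr (.inl k)) ⬝ᵥ z = P.vertexCost k ⬝ᵥ (z ∘ Sum.inl) - z (.inr (.inl 0)) +
      z (.inr (.inl 1)) + z (.inr (.inr (Fin.castAdd 2 k))) := by
  simp [aBar, dotProduct, Pi.single_apply]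
  ring

theorem aBar_zero_dotProduct (z : Var n q → ℝ) :
    P.aBar (.inr (.inr 0)) ⬝ᵥ z = z (.inr (.inl 0)) + z (.inr (.inr (Fin.natAdd q 0))) := by
  simp [aBar, dotProduct, Pi.single_apply]

theorem aBar_one_dotProduct (z : Var n q → ℝ) :
    P.aBar (.inr (.inr 1)) ⬝ᵥ z = z (.inr (.inl 0)) - z (.inr (.inl 1)) +
      z (.inr (.inr (Fin.natAdd q 1))) := by
  simp [aBar, dotProduct, Pi.single_apply]
  ring

theorem f_eq (z : Var n q → ℝ) :
    P.f z = P.robustForm (z ∘ Sum.inl) + (z (.inr (.inl 0)) - z (.inr (.inl 1))) := by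
  simp [f, W, w, robustForm, Matrix.fromBlocks_mulVec, dotProduct]
  ring

/-- The feasible set of the lifted mixed-binary program in standard form. -/
def liftedSet : Set (Var n q → ℝ) :=
  {z | 0 ≤ z ∧ (∀ j, P.aBar j ⬝ᵥ z = P.bBar j) ∧
    ∀ i, z (.inl (P.bin i)) = 0 ∨ z (.inl (P.bin i)) = 1}

/-- Row `k` with its nonnegative slack bounds the `k`-th vertex cost by `t₁ - t₂`. -/
theorem infRP_le_f (hρ : 0 ≤ P.ρ) {z : Var n q → ℝ} (hz : z ∈ P.liftedSet) :
    P.infRP ≤ (P.f z : EReal) := by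
  obtain ⟨hz0, hzl, hzb⟩ := hz
  have hx : z ∘ Sum.inl ∈ P.feasibleSet :=
    ⟨fun j => by rw [← P.aBar_inl_dotProduct, hzl]; rfl, fun i => hz0 _, hzb⟩
  rw [f_eq]
  refine (iInf₂_le _ hx).trans (P.worstCase_le hρ fun k => ?_)
  have h1 := hzl (.inr (.inl k))
  rw [aBar_vertex_dotProduct] at h1
  have h2 := hz0 (.inr (.inr (Fin.castAdd 2 k)))
  simp only [bBar, Pi.zero_apply] at h1 h2
  linarith

theorem exists_mem_liftedSet (hρ : 0 ≤ P.ρ) (hq : 0 < q)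
    (hM : IsGreatest (insert 0 P.vertexValues) P.M) {x : Fin n → ℝ} (hx : x ∈ P.feasibleSet) :
    ∃ z ∈ P.liftedSet, (P.f z : EReal) ≤ P.worstCase x := by
  have : Nonempty (Fin q) := ⟨⟨0, hq⟩⟩
  obtain ⟨k₀, hk₀⟩ := Finite.exists_max fun k => P.vertexCost k ⬝ᵥ x
  set T := P.vertexCost k₀ ⬝ᵥ x
  have hT : T ≤ P.M := hM.2 (.inr ⟨x, hx, k₀, rfl⟩)
  have h0 : 0 ≤ P.M := hM.2 (.inl rfl)
  -- With `t₁ = T⁺` and `t₂ = T⁻`, the last two slacks are nonnegative because `M` dominates both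
  -- `T` and 0.
  let slack : Fin (q + 2) → ℝ :=
    Fin.append (fun k => T - P.vertexCost k ⬝ᵥ x) ![P.M - max T 0, P.M - T]
  have hdiff : max T 0 - max (-T) 0 = T := by
    rcases le_total T 0 with h | h <;> simp [h]
  let z : Var n q → ℝ := Sum.elim x (Sum.elim ![max T 0, max (-T) 0] slack)
  have hzx : z ∘ Sum.inl = x := rfl
  refine ⟨z, ⟨?_, ?_, hx.2.2⟩, ?_⟩
  · rintro (i | i | i)
    · exact hx.2.1 i
    · fin_cases i
      · exact le_max_right T 0
      · exact le_max_right (-T) 0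
    · refine Fin.addCases (fun k => ?_) (fun k => ?_) i
      · simpa [z, slack] using hk₀ k
      · fin_cases k
        · simpa [z, slack, Fin.append_right] using ⟨hT, h0⟩
        · simpa [z, slack, Fin.append_right] using hT
  · rintro (j | k | r)
    · rw [aBar_inl_dotProduct]
      exact hx.1 j
    · rw [aBar_vertex_dotProduct, hzx]
      simp only [z, slack, bBar, Sum.elim_inl, Sum.elim_inr, Fin.append_left,
        Matrix.cons_val_zero, Matrix.cons_val_one]
      linarith
    · fin_cases r
      · refine (P.aBar_zero_dotProduct z).trans ?_
        simp only [z, slack, bBar, Sum.elim_inl, Sum.elim_inr, Fin.append_right,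
          Matrix.cons_val_zero]
        ring
      · refine (P.aBar_one_dotProduct z).trans ?_
        simp only [z, slack, bBar, Sum.elim_inl, Sum.elim_inr, Fin.append_right,
          Matrix.cons_val_zero, Matrix.cons_val_one]
        linarith
  · rw [f_eq, hzx]
    simp only [z, Sum.elim_inl, Sum.elim_inr, Matrix.cons_val_zero, Matrix.cons_val_one]
    rw [hdiff]
    exact P.le_worstCase hρ x k₀

/-- The row `t₁ + v = 0` kills `t₁`; any vertex row then reads `t₂ + v = 0` and kills `t₂`, which is
where `q ≥ 1` enters. -/
theorem eq_zero_of_aBar_dotProduct_eq_zero (hq : 0 < q)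
    (hrec : ∀ d : Fin n → ℝ, 0 ≤ d → (∀ j, P.a j ⬝ᵥ d = 0) → d = 0)
    {z : Var n q → ℝ} (hz0 : 0 ≤ z) (hz : ∀ j, P.aBar j ⬝ᵥ z = 0) : z = 0 := by
  have hx : z ∘ Sum.inl = 0 :=
    hrec _ (fun i => hz0 _) fun j => by rw [← aBar_inl_dotProduct, hz]
  have h0 := hz (.inr (.inr 0))
  have h1 := hz (.inr (.inr 1))
  have hk := fun k => hz (.inr (.inl k))
  rw [aBar_zero_dotProduct] at h0
  rw [aBar_one_dotProduct] at h1
  simp only [aBar_vertex_dotProduct, hx, dotProduct_zero] at hk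
  have n1 := hz0 (.inr (.inl 0))
  have n2 := hz0 (.inr (.inl 1))
  have n3 := hz0 (.inr (.inr (Fin.natAdd q 0)))
  have n4 := hz0 (.inr (.inr (Fin.natAdd q 1)))
  have nk := fun k : Fin q => hz0 (.inr (.inr (Fin.castAdd 2 k)))
  simp only [Pi.zero_apply] at n1 n2 n3 n4 nk
  have ht1 : z (.inr (.inl 0)) = 0 := by linarith
  have ht2 : z (.inr (.inl 1)) = 0 := by linarith [hk ⟨0, hq⟩, nk ⟨0, hq⟩]
  ext (i | i | i)
  · exact congrFun hx i
  · fin_cases i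
    · exact ht1
    · exact ht2
  · refine Fin.addCases (fun k => ?_) (fun k => ?_) i
    · simp only [Pi.zero_apply]; linarith [hk k]
    · fin_cases k
      · simp only [Pi.zero_apply, Fin.zero_eta]; linarith
      · simp only [Pi.zero_apply, Fin.mk_one]; linarith

/-! ### Homogenization and pointwise feasibility. -/

/-- The homogenization of `f - r` on pairs `(τ, z)`. -/
def homObjective (r : ℝ) (y : ℝ × (Var n q → ℝ)) : ℝ :=
  y.2 ⬝ᵥ P.W.mulVec y.2 + y.1 * (w n q ⬝ᵥ y.2) - r * y.1 ^ 2

/-- The homogenizations of the dualized equality constraints on pairs `(τ, z)`. -/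
noncomputable def homConstraint : Lin m q ⊕ Lin m q ⊕ Fin s → ℝ × (Var n q → ℝ) → ℝ
  | .inl j, y => y.1 * (P.aBar j ⬝ᵥ y.2 - P.bBar j * y.1)
  | .inr (.inl j), y => (P.aBar j ⬝ᵥ y.2) ^ 2 - P.bBar j ^ 2 * y.1 ^ 2
  | .inr (.inr i), y => y.2 (.inl (P.bin i)) * (y.2 (.inl (P.bin i)) - y.1)

theorem homObjective_smul (r c : ℝ) (y : ℝ × (Var n q → ℝ)) :
    P.homObjective r (c • y) = c ^ 2 * P.homObjective r y := by
  simp only [homObjective, Prod.smul_fst, Prod.smul_snd, Matrix.mulVec_smul, dotProduct_smul,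
    smul_dotProduct, smul_eq_mul]
  ring

theorem homConstraint_smul (k : Lin m q ⊕ Lin m q ⊕ Fin s) (c : ℝ) (y : ℝ × (Var n q → ℝ)) :
    P.homConstraint k (c • y) = c ^ 2 * P.homConstraint k y := by
  rcases k with j | j | i <;>
    simp only [homConstraint, Prod.smul_fst, Prod.smul_snd, dotProduct_smul, Pi.smul_apply,
      smul_eq_mul] <;> ring

theorem continuous_homObjective (r : ℝ) : Continuous (P.homObjective r) := by
  unfold homObjective
  simp only [dotProduct, Matrix.mulVec]
  fun_prop

theorem continuous_homConstraint (k : Lin m q ⊕ Lin m q ⊕ Fin s) :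
    Continuous (P.homConstraint k) := by
  have hdot : ∀ v : Var n q → ℝ, Continuous fun y : ℝ × (Var n q → ℝ) => v ⬝ᵥ y.2 := fun v => by
    simp only [dotProduct]; fun_prop
  rcases k with j | j | i
  · exact continuous_fst.mul ((hdot _).sub (continuous_const.mul continuous_fst))
  · exact ((hdot _).pow 2).sub (continuous_const.mul (continuous_fst.pow 2))
  · have : Continuous fun y : ℝ × (Var n q → ℝ) => y.2 (.inl (P.bin i)) := by fun_prop
    exact this.mul (this.sub continuous_fst)

theorem homObjective_pos (hρ : 0 ≤ P.ρ) {r : ℝ} (hr : (r : EReal) < P.infRP)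
    {y : ℝ × (Var n q → ℝ)} (hy : 0 < y.1) (hz : y.1⁻¹ • y.2 ∈ P.liftedSet) :
    0 < P.homObjective r y := by
  have h1 : r < P.f (y.1⁻¹ • y.2) := EReal.coe_lt_coe_iff.1 (hr.trans_le (P.infRP_le_f hρ hz))
  have h2 : y = y.1 • ((1 : ℝ), y.1⁻¹ • y.2) := by
    ext <;> simp [hy.ne']
  rw [h2, homObjective_smul]
  refine mul_pos (by positivity) ?_
  simp only [homObjective]
  simp only [f] at h1
  linarith

/-- A convex combination of points of the homogenized orthant that satisfies the lifted linear
equations and their squares on average satisfies them pointwise. -/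
theorem aBar_dotProduct_eq_of_sum_eq_zero {ι : Type} {t : Finset ι} {p : ι → ℝ}
    {y : ι → ℝ × (Var n q → ℝ)} (hp : ∀ i ∈ t, 0 ≤ p i)
    (h : ∀ k, ∑ i ∈ t, p i * P.homConstraint k (y i) = 0) (j : Lin m q) {i : ι} (hi : i ∈ t)
    (hpi : 0 < p i) : P.aBar j ⬝ᵥ (y i).2 = P.bBar j * (y i).1 := by
  -- The square is the squared constraint minus `2 * bBar j` times the linear one; this is why both
  -- are dualized.
  have hsum : ∑ i ∈ t, p i * (P.aBar j ⬝ᵥ (y i).2 - P.bBar j * (y i).1) ^ 2 = 0 := by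
    have h1 := h (.inl j)
    have h2 := h (.inr (.inl j))
    calc _ = ∑ i ∈ t, (p i * P.homConstraint (.inr (.inl j)) (y i) -
          2 * P.bBar j * (p i * P.homConstraint (.inl j) (y i))) :=
        Finset.sum_congr rfl fun i _ => by simp only [homConstraint]; ring
      _ = 0 := by rw [Finset.sum_sub_distrib, ← Finset.mul_sum, h1, h2]; simp
  have := (Finset.sum_eq_zero_iff_of_nonneg
    fun i hi => mul_nonneg (hp i hi) (sq_nonneg _)).1 hsum i hi
  have := pow_eq_zero_iff two_ne_zero |>.1 ((mul_eq_zero.1 this).resolve_left hpi.ne')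
  linarith

theorem sum_homObjective_pos (hρ : 0 ≤ P.ρ) (hq : 0 < q) (hRA : P.RA)
    (hrec : ∀ d : Fin n → ℝ, 0 ≤ d → (∀ j, P.a j ⬝ᵥ d = 0) → d = 0)
    {r : ℝ} (hr : (r : EReal) < P.infRP) {ι : Type} {t : Finset ι} {p : ι → ℝ}
    {y : ι → ℝ × (Var n q → ℝ)} (hp : ∀ i ∈ t, 0 ≤ p i) (hp1 : ∑ i ∈ t, p i = 1)
    (hy0 : ∀ i ∈ t, 0 ≤ y i) (hy : ∀ i ∈ t, y i ≠ 0)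
    (h : ∀ k, ∑ i ∈ t, p i * P.homConstraint k (y i) = 0) :
    0 < ∑ i ∈ t, p i * P.homObjective r (y i) := by
  have hlin := fun j i => P.aBar_dotProduct_eq_of_sum_eq_zero hp h j (i := i)
  have hτ : ∀ i ∈ t, 0 < p i → 0 < (y i).1 := fun i hi hpi => by
    refine lt_of_le_of_ne (hy0 i hi).1 fun h0 => hy i hi (Prod.ext h0.symm ?_)
    exact P.eq_zero_of_aBar_dotProduct_eq_zero hq hrec (hy0 i hi).2
      fun j => by rw [hlin j i hi hpi, ← h0, mul_zero]
  have hbin_le : ∀ i ∈ t, 0 < p i → ∀ l, (y i).2 (.inl (P.bin l)) ≤ (y i).1 := fun i hi hpi l => by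
    have h1 := (hRA ((y i).1⁻¹ • ((y i).2 ∘ Sum.inl))
      (smul_nonneg (inv_nonneg.2 (hτ i hi hpi).le) fun a => (hy0 i hi).2 _) (fun j => by
        rw [dotProduct_smul, ← aBar_inl_dotProduct, hlin _ i hi hpi, smul_eq_mul, mul_comm,
          mul_assoc, mul_inv_cancel₀ (hτ i hi hpi).ne', mul_one]
        rfl) l).2
    simpa [inv_mul_le_iff₀ (hτ i hi hpi)] using h1
  have hbin : ∀ i ∈ t, 0 < p i → ∀ l,
      (y i).2 (.inl (P.bin l)) = 0 ∨ (y i).2 (.inl (P.bin l)) = (y i).1 := fun i hi hpi l => by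
    have h1 := h (.inr (.inr l))
    -- By (RA) every binary term is nonpositive, so a zero sum makes each one vanish.
    have h2 : ∀ i ∈ t, p i * P.homConstraint (.inr (.inr l)) (y i) ≤ 0 := fun i hi => by
      rcases (hp i hi).eq_or_lt with h0 | hpi
      · simp [← h0]
      · exact mul_nonpos_of_nonneg_of_nonpos hpi.le (mul_nonpos_of_nonneg_of_nonpos
          ((hy0 i hi).2 _) (sub_nonpos.2 (hbin_le i hi hpi l)))
    have h3 := (Finset.sum_eq_zero_iff_of_nonpos h2).1 h1 i hi
    rcases mul_eq_zero.1 ((mul_eq_zero.1 h3).resolve_left hpi.ne') with h4 | h4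
    · exact .inl h4
    · exact .inr (sub_eq_zero.1 h4)
  have hpos : ∀ i ∈ t, 0 < p i → 0 < P.homObjective r (y i) := fun i hi hpi => by
    have hτi := hτ i hi hpi
    refine P.homObjective_pos hρ hr hτi
      ⟨smul_nonneg (inv_nonneg.2 hτi.le) (hy0 i hi).2, fun j => ?_, fun l => ?_⟩
    · rw [dotProduct_smul, hlin j i hi hpi, smul_eq_mul, mul_comm, mul_assoc,
        mul_inv_cancel₀ hτi.ne', mul_one]
    · rcases hbin i hi hpi l with h1 | h1
      · left; simp [h1]
      · right; simp [h1, hτi.ne']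
  obtain ⟨i, hi, hpi⟩ : ∃ i ∈ t, 0 < p i := by
    by_contra! hcon
    linarith [Finset.sum_nonpos hcon]
  refine Finset.sum_pos' (fun i hi => ?_) ⟨i, hi, mul_pos hpi (hpos i hi hpi)⟩
  rcases (hp i hi).eq_or_lt with h0 | hpi
  · simp [← h0]
  · exact (mul_pos hpi (hpos i hi hpi)).le

theorem exists_homogeneous_multiplier (hρ : 0 ≤ P.ρ) (hq : 0 < q) (hRA : P.RA)
    (hrec : ∀ d : Fin n → ℝ, 0 ≤ d → (∀ j, P.a j ⬝ᵥ d = 0) → d = 0)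
    {r : ℝ} (hr : (r : EReal) < P.infRP) :
    ∃ μ : Lin m q ⊕ Lin m q ⊕ Fin s → ℝ, ∀ y : ℝ × (Var n q → ℝ), 0 ≤ y → y ≠ 0 →
      0 < P.homObjective r y + ∑ k, μ k * P.homConstraint k y := by
  have hX : IsCompact (Metric.sphere (0 : ℝ × (Var n q → ℝ)) 1 ∩ Set.Ici 0) :=
    (isCompact_sphere 0 1).inter_right isClosed_Ici
  obtain ⟨μ, hμ⟩ := exists_multiplier_of_isCompact hX (P.continuous_homObjective r)
    P.continuous_homConstraint fun ι t p y hp hp1 hy h =>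
      P.sum_homObjective_pos hρ hq hRA hrec hr hp hp1 (fun i hi => (hy i hi).2)
        (fun i hi h0 => by simpa [h0] using (hy i hi).1) h
  refine ⟨μ, fun y hy0 hy => ?_⟩
  have hn : 0 < ‖y‖ := norm_pos_iff.2 hy
  have h1 := hμ (‖y‖⁻¹ • y) ⟨by simp [norm_smul, hn.ne'],
    smul_nonneg (inv_nonneg.2 hn.le) hy0⟩
  simp only [homObjective_smul, homConstraint_smul] at h1
  have h2 : ∑ k, μ k * (‖y‖⁻¹ ^ 2 * P.homConstraint k y) =
      ‖y‖⁻¹ ^ 2 * ∑ k, μ k * P.homConstraint k y := by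
    rw [Finset.mul_sum]
    exact Finset.sum_congr rfl fun k _ => by ring
  rw [h2, ← mul_add] at h1
  exact pos_of_mul_pos_right h1 (by positivity)

/-! ### Dual multipliers and the two inequalities. -/

/-- Nonnegative multipliers for the constraints `g` from signed ones for the equalities. -/
def splitMultiplier (μ : Lin m q ⊕ Lin m q ⊕ Fin s → ℝ) :
    (Lin m q ⊕ Lin m q) ⊕ (Lin m q ⊕ Lin m q) ⊕ (Fin s ⊕ Fin s) → ℝ
  | .inl (.inl j) => (μ (.inl j))⁺
  | .inl (.inr j) => (μ (.inl j))⁻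
  | .inr (.inl (.inl j)) => (μ (.inr (.inl j)))⁺
  | .inr (.inl (.inr j)) => (μ (.inr (.inl j)))⁻
  | .inr (.inr (.inl i)) => (μ (.inr (.inr i)))⁺
  | .inr (.inr (.inr i)) => (μ (.inr (.inr i)))⁻

theorem splitMultiplier_nonneg (μ : Lin m q ⊕ Lin m q ⊕ Fin s → ℝ) :
    0 ≤ splitMultiplier μ := by
  rintro ((j | j) | (j | j) | (i | i))
  exacts [posPart_nonneg _, negPart_nonneg _, posPart_nonneg _, negPart_nonneg _,
    posPart_nonneg _, negPart_nonneg _]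

theorem sum_splitMultiplier (μ : Lin m q ⊕ Lin m q ⊕ Fin s → ℝ) (z : Var n q → ℝ) :
    ∑ k, splitMultiplier μ k * P.g k z = ∑ k, μ k * P.homConstraint k (1, z) := by
  have key : ∀ a x : ℝ, a⁺ * x + a⁻ * -x = a * x := fun a x => by
    rw [mul_neg, ← sub_eq_add_neg, ← sub_mul, posPart_sub_negPart]
  simp only [Fintype.sum_sum_type (α₁ := Lin m q ⊕ Lin m q),
    Fintype.sum_sum_type (α₂ := Fin s),
    Fintype.sum_sum_type (α₁ := Lin m q) (α₂ := Lin m q ⊕ Fin s),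
    Fintype.sum_sum_type (α₁ := Lin m q) (α₂ := Lin m q), ← Finset.sum_add_distrib]
  congr 1
  · refine Finset.sum_congr rfl fun j _ => ?_
    refine Eq.trans ?_ (key _ _)
    simp only [splitMultiplier, g, homConstraint]
    ring
  · congr 1
    · refine Finset.sum_congr rfl fun j _ => ?_
      refine Eq.trans ?_ (key _ _)
      simp only [splitMultiplier, g, homConstraint]
      ring
    · refine Finset.sum_congr rfl fun j _ => ?_
      refine Eq.trans ?_ (key _ _)
      simp only [splitMultiplier, g, homConstraint]

theorem infRP_le_supDRP (hρ : 0 ≤ P.ρ) (hq : 0 < q) (hRA : P.RA)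
    (hrec : ∀ d : Fin n → ℝ, 0 ≤ d → (∀ j, P.a j ⬝ᵥ d = 0) → d = 0) :
    P.infRP ≤ P.supDRP := by
  refine EReal.ge_of_forall_gt_iff_ge.1 fun r hr => ?_
  obtain ⟨μ, hμ⟩ := P.exists_homogeneous_multiplier hρ hq hRA hrec hr
  refine le_iSup₂_of_le (splitMultiplier μ) (splitMultiplier_nonneg μ)
    (le_iInf₂ fun z hz => EReal.coe_le_coe_iff.2 ?_)
  -- At `τ = 1` the homogeneous inequality says that the Lagrangian exceeds `r`.
  have h1 := hμ (1, z) ⟨zero_le_one, hz⟩ fun h0 => one_ne_zero (congrArg Prod.fst h0)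
  rw [sum_splitMultiplier]
  simp only [homObjective] at h1
  simp only [f]
  linarith

theorem supDRP_le_infRP (hρ : 0 ≤ P.ρ) (hq : 0 < q)
    (hM : IsGreatest (insert 0 P.vertexValues) P.M) : P.supDRP ≤ P.infRP := by
  refine iSup₂_le fun u _ => le_iInf₂ fun x hx => ?_
  obtain ⟨z, hz, hzx⟩ := P.exists_mem_liftedSet hρ hq hM hx
  refine (iInf₂_le z hz.1).trans (le_trans (le_of_eq ?_) hzx)
  rw [Finset.sum_eq_zero, add_zero]
  rintro ((j | j) | (j | j) | (i | i)) -
  iterate 4 simp [g, hz.2.1 j]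
  all_goals rcases hz.2.2 i with h | h <;> simp [g, h]

end RobustMIQP

theorem theorem4p1 {n m s L q : ℕ} (P : RobustMIQP n m s L q)
    (hq : 0 < q) (hρ : 0 ≤ P.ρ)
    (hC : P.feasibleSet.Nonempty)
    (hRA : P.RA)
    (hd : {d : Fin n → ℝ | 0 ≤ d ∧ (∀ j, P.a j ⬝ᵥ d = 0) ∧ ∀ i, d (P.bin i) = 0} = {0}) :
    IsGreatest (insert 0 P.vertexValues) P.M ∧ P.infRP = P.supDRP := by
  have hM := P.isGreatest_M hq hC (P.isCompact_feasibleSet hC hRA hd)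
  have hrec := fun d => P.eq_zero_of_dotProduct_eq_zero hC hRA hd (d := d)
  exact ⟨hM, (P.infRP_le_supDRP hρ hq hRA hrec).antisymm (P.supDRP_le_infRP hρ hq hM)⟩
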